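/- Let $d\ge 2$ and let $S^d$ be the unit sphere of $\mathbb{R}^{d+1}$. The spherical distance $|ab|$ of $a,b\in S^d$ is the length of the shorter great-circle arc joining them (so $|ab|=\pi$ for antipodes). A set $C\subset S^d$ is convex if it contains no pair of antipodes and if, with any two points $a,b\in C$, it contains the shorter great-circle arc $ab$; a spherical convex body is a closed convex subset of $S^d$ with non-empty interior. For $m\in S^d$ let $H(m)=\{x\in S^d:|mx|\le \pi/2\}$ be the hemisphere with center $m$. It supports a spherical convex body $C$ if $C\subset H(m)$ and $\mathrm{bd}(C)\cap\mathrm{bd}(H(m))\neq\emptyset$. If hemispheres $G,H$ are different and not opposite (that is, their centers are neither equal nor antipodal), then $G\cap H$ is a lune; it is bounded by the two $(d-1)$-dimensional hemispheres $\mathrm{bd}(G)\cap H$ and $\mathrm{bd}(H)\cap G$, and its thickness is the spherical distance of the centers of these two. The width of $C$ determined by a supporting hemisphere $K$ of $C$ is the minimum of the thicknesses of the lunes $K\cap K'$ over all hemispheres $K'$ supporting $C$ (different from $K$). The body $C$ is of constant width $w$ if its width determined by every supporting hemisphere equals $w$. The body $C$ is of constant diameter $w$ if $\sup_{p,q\in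 C}|pq|=w$ and for every $p\in\mathrm{bd}(C)$ there is $p'\in C$ with $|pp'|=w$. **Theorem.** Let $W\subset S^d$ be a spherical convex body and let $w$ be a real number. 1. If $W$ is of constant width $w$, then $W$ is of constant diameter $w$. 2. If $w\ge\frac{\pi}{2}$ and $W$ is of constant diameter $w$, then $W$ is of constant width $w$. -/

import Mathlib

namespace SphConvex

/-- The unit sphere `S^d` of the Euclidean space `E^{d+1}`, with its subspace topology. -/
abbrev Sph (d : ℕ) : Type := Metric.sphere (0 : EuclideanSpace ℝ (Fin (d + 1))) 1

variable {d : ℕ}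

/-- The spherical distance `|ab|`: the length of the shorter great-circle arc from `a` to `b`,
that is, the angle between the two unit vectors (`0` for equal points, `π` for antipodes). -/
noncomputable def sdist (a b : Sph d) : ℝ :=
  InnerProductGeometry.angle (a : EuclideanSpace ℝ (Fin (d + 1)))
    (b : EuclideanSpace ℝ (Fin (d + 1)))

/-- The arc `ab`, the shorter part of the great circle through `a` and `b`: the points of the
sphere in the cone spanned by `a` and `b`. It is meant for points that are not antipodes. -/
def arc (a b : Sph d) : Set (Sph d) :=
  {x | ∃ s t : ℝ, 0 ≤ s ∧ 0 ≤ t ∧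
    (x : EuclideanSpace ℝ (Fin (d + 1))) =
      s • (a : EuclideanSpace ℝ (Fin (d + 1))) + t • (b : EuclideanSpace ℝ (Fin (d + 1)))}

/-- A set is (spherically) convex if it contains no pair of antipodes and contains the arc
between any two of its points. -/
def IsConvex (C : Set (Sph d)) : Prop :=
  (∀ a ∈ C, -a ∉ C) ∧ ∀ a ∈ C, ∀ b ∈ C, arc a b ⊆ C

/-- A spherical convex body: a closed convex set with non-empty interior. -/
def IsConvexBody (C : Set (Sph d)) : Prop :=
  IsClosed C ∧ IsConvex C ∧ (interior C).Nonempty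

/-- The hemisphere `H(m)` with center `m`. -/
def hemisphere (m : Sph d) : Set (Sph d) :=
  {x | sdist m x ≤ Real.pi / 2}

/-- The hemisphere `H(m)` supports `C`: it contains `C`, and the boundaries have a common point. -/
def Supports (m : Sph d) (C : Set (Sph d)) : Prop :=
  C ⊆ hemisphere m ∧ (frontier C ∩ frontier (hemisphere m)).Nonempty

/-- The part `bd H(g) ∩ H(h)` of the boundary of the lune `H(g) ∩ H(h)`; it is one of the two
`(d-1)`-dimensional hemispheres bounding the lune. -/
def luneFace (g h : Sph d) : Set (Sph d) :=
  frontier (hemisphere g) ∩ hemisphere h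

/-- `c` is the center of the `(d-1)`-dimensional hemisphere `bd H(g) ∩ H(h)`: `c` lies on the
great sphere `bd H(g)`, and the hemisphere consists of the points of that great sphere at
distance at most `π/2` from `c`. -/
def IsFaceCenter (g h c : Sph d) : Prop :=
  c ∈ frontier (hemisphere g) ∧
    luneFace g h = {x | x ∈ frontier (hemisphere g) ∧ sdist c x ≤ Real.pi / 2}

/-- `H(g)` and `H(h)` are different and not opposite, so that `H(g) ∩ H(h)` is a lune, and the
thickness of this lune, the distance of the centers of the two `(d-1)`-dimensional hemispheres
bounding it, is `t`. -/
def IsLuneThickness (g h : Sph d) (t : ℝ) : Prop :=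
  g ≠ h ∧ g ≠ -h ∧ ∃ c c' : Sph d, IsFaceCenter g h c ∧ IsFaceCenter h g c' ∧ t = sdist c c'

/-- The width of `C` determined by the hemisphere `H(k)` is `w`: this is the minimum of the
thicknesses of the lunes `H(k) ∩ H(m)`, over all hemispheres `H(m)` supporting `C`. -/
def IsWidth (k : Sph d) (C : Set (Sph d)) (w : ℝ) : Prop :=
  IsLeast {t | ∃ m : Sph d, Supports m C ∧ IsLuneThickness k m t} w

/-- `C` is of constant width `w`: its width determined by any supporting hemisphere is `w`. -/
def IsOfConstantWidth (C : Set (Sph d)) (w : ℝ) : Prop :=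
  ∀ k : Sph d, Supports k C → IsWidth k C w

/-- The diameter of `C` is `w`. -/
def IsDiameter (C : Set (Sph d)) (w : ℝ) : Prop :=
  IsLUB {r | ∃ p ∈ C, ∃ q ∈ C, r = sdist p q} w

/-- `C` is of constant diameter `w`: its diameter is `w`, and every boundary point of `C` is at
distance `w` from some point of `C`. -/
def IsOfConstantDiameter (C : Set (Sph d)) (w : ℝ) : Prop :=
  IsDiameter C w ∧ ∀ p ∈ frontier C, ∃ q ∈ C, sdist p q = w

end SphConvex

/-!
Replace a body `W` by the closed convex cone `K` over it. The supporting hemispheres of `W` are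
centered at the unit vectors of the dual cone `K*` that are orthogonal to some unit vector of `K`,
and the lune of two such centers `k`, `m` has thickness `π - |km|`. Hence `W` has constant
diameter `w` if and only if the unit vectors of `K` form a set of constant diameter `w`, and `W`
has constant width `w` if and only if those of `K*` form a set of constant diameter `π - w`. As
`K** = K`, it suffices to show that constant diameter `δ` of `K` implies constant diameter `π - δ`
of `K*`.

Let `x ∈ K` and `k ∈ K*` be orthogonal unit vectors, and let `y = cos δ • x + sin δ • k`. The point
of `K` at distance `δ` from `x` has to be `y`, and the arc from `y` to `x` starts in a direction
that lies in `K*`, at distance `π - δ` from `k`. On the other hand, if `k`, `k'` are unit vectors of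
`K*` at maximal distance, then the direction `x` of the arc from `k` to `k'` lies in `K** = K`, and
`⟪y, k'⟫ ≥ 0` says exactly that this distance is at most `π - δ`.

The proof that `y ∈ K` depends on `δ`. If `δ ≤ π / 2`, then every point within distance `δ` of all
of `K` belongs to `K`; were `y` not such a point, `x` could be moved out of the half-space of `k`
within `K`. If `δ > π / 2`, let `q ∈ K` be at distance `δ` from `x`. Bessel's inequality gives
`⟪q, k⟫ ≤ sin δ`, so that `⟪q, k'⟫ ≥ 0` still implies `⟪y, k'⟫ ≥ 0` and hence the bound `π - δ` for
the distances in `K*`; this bound, applied to `k` and the direction from `q` to `x`, gives `q = y`.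
-/

namespace SphConvex

open scoped RealInnerProductSpace
open ProperCone

section Directions

variable {E : Type*} [NormedAddCommGroup E] [InnerProductSpace ℝ E] {a x k v z : E}

/-- The unit tangent vector at `a` of the great-circle arc from the unit vector `a` to the unit
vector `z`. It is `0` if `z = a` or `z = -a`. -/
noncomputable def arcDirection (a z : E) : E :=
  (√(1 - ⟪a, z⟫ ^ 2))⁻¹ • (z - ⟪a, z⟫ • a)

lemma inner_arcDirection_left (ha : ‖a‖ = 1) (z : E) : ⟪a, arcDirection a z⟫ = 0 := by
  simp [arcDirection, inner_smul_right, inner_sub_right, ha]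

lemma sqrt_smul_arcDirection (h : ⟪a, z⟫ ∈ Set.Ioo (-1) 1) :
    √(1 - ⟪a, z⟫ ^ 2) • arcDirection a z = z - ⟪a, z⟫ • a :=
  smul_inv_smul₀ (Real.sqrt_pos.2 (by nlinarith [h.1, h.2])).ne' _

lemma norm_arcDirection (ha : ‖a‖ = 1) (hz : ‖z‖ = 1) (h : ⟪a, z⟫ ∈ Set.Ioo (-1) 1) :
    ‖arcDirection a z‖ = 1 := by
  have hpos : 0 < 1 - ⟪a, z⟫ ^ 2 := by nlinarith [h.1, h.2]
  have hsq : ‖z - ⟪a, z⟫ • a‖ ^ 2 = 1 - ⟪a, z⟫ ^ 2 := by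
    rw [norm_sub_sq_real, real_inner_smul_right, norm_smul, ha, hz, real_inner_comm,
      Real.norm_eq_abs, mul_one, sq_abs]
    ring
  rw [arcDirection, norm_smul, norm_inv, Real.norm_of_nonneg (Real.sqrt_nonneg _), ← hsq,
    Real.sqrt_sq (norm_nonneg _)]
  exact inv_mul_cancel₀ fun h0 => by simp [← hsq, h0] at hpos

lemma inner_arcDirection_arcDirection (ha : ‖a‖ = 1) (hz : ‖z‖ = 1)
    (h : ⟪a, z⟫ ∈ Set.Ioo (-1) 1) : ⟪arcDirection a z, arcDirection z a⟫ = -⟪a, z⟫ := by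
  have hpos : 0 < 1 - ⟪a, z⟫ ^ 2 := by nlinarith [h.1, h.2]
  have hsq := Real.sq_sqrt hpos.le
  have hne := (Real.sqrt_pos.2 hpos).ne'
  simp only [arcDirection, real_inner_smul_left, real_inner_smul_right, inner_sub_left,
    inner_sub_right, real_inner_comm a z, real_inner_self_eq_norm_sq, ha, hz]
  field_simp
  rw [hsq]
  ring

lemma inner_arcDirection_nonneg_iff (h : ⟪a, z⟫ ∈ Set.Ioo (-1) 1) (hx : ⟪a, x⟫ = 0) :
    0 ≤ ⟪arcDirection a z, x⟫ ↔ 0 ≤ ⟪z, x⟫ := by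
  have hpos : 0 < (√(1 - ⟪a, z⟫ ^ 2))⁻¹ :=
    inv_pos.2 (Real.sqrt_pos.2 (by nlinarith [h.1, h.2]))
  rw [arcDirection, real_inner_smul_left, inner_sub_left, real_inner_smul_left, hx, mul_zero,
    sub_zero, mul_nonneg_iff_of_pos_left hpos]

lemma eq_of_forall_inner_nonneg (hk : ‖k‖ = 1) (hv : ‖v‖ = 1) (hak : ⟪a, k⟫ = 0)
    (hav : ⟪a, v⟫ = 0)
    (h : ∀ x, ‖x‖ = 1 → ⟪a, x⟫ = 0 → 0 ≤ ⟪k, x⟫ → 0 ≤ ⟪v, x⟫) : k = v := by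
  by_contra hne
  have hlt : ⟪v, k⟫ < 1 := (inner_lt_one_iff_real_of_norm_eq_one hv hk).2 (Ne.symm hne)
  have hpos : 0 < ‖k - v‖⁻¹ := inv_pos.2 (norm_pos_iff.2 (sub_ne_zero.2 hne))
  have hnonneg := h (NormedSpace.normalize (k - v))
    (NormedSpace.norm_normalize_eq_one_iff.2 (sub_ne_zero.2 hne))
    (by rw [NormedSpace.normalize, real_inner_smul_right, inner_sub_right, hak, hav, sub_zero,
      mul_zero])
    (by
      rw [NormedSpace.normalize, real_inner_smul_right, inner_sub_right,
        real_inner_self_eq_norm_sq, hk, real_inner_comm]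
      exact mul_nonneg hpos.le (by linarith))
  rw [NormedSpace.normalize, real_inner_smul_right, mul_nonneg_iff_of_pos_left hpos,
    inner_sub_right, real_inner_self_eq_norm_sq, hv] at hnonneg
  linarith

lemma inner_mem_Ioo_of_norm_eq_one (hx : ‖x‖ = 1) (hv : ‖v‖ = 1) (h : x ≠ v) (h' : x ≠ -v) :
    ⟪x, v⟫ ∈ Set.Ioo (-1) 1 := by
  have hle := abs_le.1 ((abs_real_inner_le_norm x v).trans_eq (by rw [hx, hv, one_mul]))
  exact ⟨hle.1.lt_of_ne' fun h0 => h' ((inner_eq_neg_one_iff_of_norm_eq_one (𝕜 := ℝ) hx hv).1 h0),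
    (inner_lt_one_iff_real_of_norm_eq_one hx hv).2 h⟩

lemma sq_inner_add_sq_inner_le (hx : ‖x‖ = 1) (hk : ‖k‖ = 1) (hxk : ⟪x, k⟫ = 0) (v : E) :
    ⟪x, v⟫ ^ 2 + ⟪k, v⟫ ^ 2 ≤ ‖v‖ ^ 2 := by
  have hon : Orthonormal ℝ ![x, k] := by
    simp [orthonormal_vecCons_iff, hx, hk, hxk]
  simpa [Fin.sum_univ_two] using hon.sum_inner_products_le v (s := Finset.univ)

lemma inner_le_of_sq_le_sq_inner {c s : ℝ} (hx : ‖x‖ = 1) (hk : ‖k‖ = 1)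
    (hxk : ⟪x, k⟫ = 0) (hv : ‖v‖ = 1) (hcs : c ^ 2 + s ^ 2 = 1) (hs : 0 ≤ s)
    (hc : c ^ 2 ≤ ⟪x, v⟫ ^ 2) : ⟪k, v⟫ ≤ s := by
  have hbessel := sq_inner_add_sq_inner_le hx hk hxk v
  rw [hv] at hbessel
  exact abs_le_of_sq_le_sq' (by linarith) hs |>.2

lemma norm_cos_smul_add_sin_smul (hx : ‖x‖ = 1) (hk : ‖k‖ = 1) (hxk : ⟪x, k⟫ = 0) (δ : ℝ) :
    ‖Real.cos δ • x + Real.sin δ • k‖ = 1 := by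
  rw [← pow_eq_one_iff_of_nonneg (norm_nonneg _) two_ne_zero, norm_add_sq_real, norm_smul,
    norm_smul, real_inner_smul_left, real_inner_smul_right, hx, hk, hxk, Real.norm_eq_abs,
    Real.norm_eq_abs, mul_one, mul_one, sq_abs, sq_abs, ← Real.cos_sq_add_sin_sq δ]
  ring

lemma norm_add_smul_le (hx : ‖x‖ = 1) (ε : ℝ) (t : E) :
    ‖x + ε • t‖ ≤ 1 + ε * ⟪x, t⟫ + ε ^ 2 * ‖t‖ ^ 2 / 2 := by
  have hsq : ‖x + ε • t‖ ^ 2 = 1 + 2 * (ε * ⟪x, t⟫) + ε ^ 2 * ‖t‖ ^ 2 := by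
    rw [norm_add_sq_real, real_inner_smul_right, norm_smul, hx, mul_pow, Real.norm_eq_abs, sq_abs,
      one_pow]
  nlinarith [sq_nonneg (‖x + ε • t‖ - 1)]

end Directions

lemma nonempty_inter_frontier {X : Type*} [TopologicalSpace X] {s t : Set X}
    (ht : IsPreconnected t) (hs : (t ∩ s).Nonempty) (hsc : (t ∩ sᶜ).Nonempty) :
    (t ∩ frontier s).Nonempty := by
  by_contra hempty
  have hfront : ∀ x ∈ t, x ∉ frontier s := fun x hxt hx => hempty ⟨x, hxt, hx⟩
  have hint : ∀ x ∈ t, x ∈ closure s → x ∈ interior s := fun x hxt hx => by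
    by_contra hn
    exact hfront x hxt ⟨hx, hn⟩
  obtain ⟨x, hxt, hxs⟩ := hs
  obtain ⟨y, hyt, hys⟩ := hsc
  obtain ⟨z, -, hzi, hzc⟩ := ht (interior s) (closure s)ᶜ isOpen_interior
    isClosed_closure.isOpen_compl (fun z hz => (em (z ∈ closure s)).imp (hint z hz) id)
    ⟨x, hxt, hint x hxt (subset_closure hxs)⟩
    ⟨y, hyt, fun hy => hys (interior_subset (hint y hyt hy))⟩
  exact hzc (subset_closure (interior_subset hzi))

section Cones

variable {E : Type*} [NormedAddCommGroup E] [InnerProductSpace ℝ E]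

lemma hasFDerivAt_norm {x : E} (hx : x ≠ 0) :
    HasFDerivAt (‖·‖) (‖x‖⁻¹ • innerSL ℝ x) x := by
  have h := (hasStrictFDerivAt_norm_sq x).hasFDerivAt.sqrt (by simpa using hx)
  simp only [Real.sqrt_sq (norm_nonneg _)] at h
  convert! h using 1
  rw [← Nat.cast_smul_eq_nsmul ℝ, smul_smul]
  congr 1
  push_cast
  field_simp

lemma exists_pos_sub_smul_mem {s : Set E} {o : E} (ho : o ∈ interior s) (v : E) :
    ∃ ε : ℝ, 0 < ε ∧ o - ε • v ∈ s := by
  have hcont : Continuous fun ε : ℝ => o - ε • v := by fun_prop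
  have hev : ∀ᶠ ε in nhdsWithin (0 : ℝ) (Set.Ioi 0), o - ε • v ∈ s :=
    (hcont.continuousAt.eventually (by simpa using mem_interior_iff_mem_nhds.1 ho)).filter_mono
      nhdsWithin_le_nhds
  obtain ⟨ε, hmem, hε⟩ := (hev.and self_mem_nhdsWithin).exists
  exact ⟨ε, hε, hmem⟩

/-- The unit vectors of a cone: the spherically convex set that the cone cuts out of the unit
sphere. -/
def unitVectors (K : ProperCone ℝ E) : Set E := {x | x ∈ K ∧ ‖x‖ = 1}

variable {K : ProperCone ℝ E} {a o x y z : E}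

lemma ne_zero_of_mem_unitVectors (hx : x ∈ unitVectors K) : x ≠ 0 :=
  norm_ne_zero_iff.1 (hx.2.trans_ne one_ne_zero)

lemma normalize_mem_unitVectors (hx : x ∈ K) (hx0 : x ≠ 0) :
    NormedSpace.normalize x ∈ unitVectors K :=
  ⟨K.smul_mem hx (by positivity), NormedSpace.norm_normalize_eq_one_iff.2 hx0⟩

lemma mul_norm_le_inner {m : ℝ} (h : ∀ u ∈ unitVectors K, m ≤ ⟪u, z⟫) (hx : x ∈ K) :
    m * ‖x‖ ≤ ⟪x, z⟫ := by
  rcases eq_or_ne x 0 with rfl | hx0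
  · simp
  · rw [← NormedSpace.norm_smul_normalize x, real_inner_smul_left, NormedSpace.norm_smul_normalize,
      mul_comm]
    exact mul_le_mul_of_nonneg_left (h _ (normalize_mem_unitVectors hx hx0)) (norm_nonneg x)

lemma mul_norm_lt_inner_of_mem_interior {c : ℝ} {v : E} (hc : |c| < 1)
    (ho : o ∈ interior (K : Set E)) (hv : ‖v‖ = 1) (h : ∀ u ∈ unitVectors K, c ≤ ⟪u, v⟫) :
    c * ‖o‖ < ⟪o, v⟫ := by
  obtain ⟨ε, hε, hmem⟩ := exists_pos_sub_smul_mem ho v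
  have hle : c * ‖o - ε • v‖ ≤ ⟪o, v⟫ - ε := by
    simpa [inner_sub_left, real_inner_smul_left, hv] using mul_norm_le_inner h hmem
  have hnorm : |‖o‖ - ‖o - ε • v‖| ≤ ε := by
    simpa [norm_smul, hv, abs_of_pos hε] using abs_norm_sub_norm_le o (o - ε • v)
  have : c * (‖o‖ - ‖o - ε • v‖) < ε := calc
    c * (‖o‖ - ‖o - ε • v‖) ≤ |c| * |‖o‖ - ‖o - ε • v‖| := (le_abs_self _).trans_eq (abs_mul _ _)
    _ ≤ |c| * ε := by gcongr
    _ < ε := mul_lt_of_lt_one_left hε hc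
  linarith

variable [CompleteSpace E]

/-- First variation of `⟪·, z⟫` at its minimum `a` among the unit vectors of `K`. -/
lemma sub_inner_smul_mem_innerDual (ha : a ∈ unitVectors K)
    (hmin : ∀ u ∈ unitVectors K, ⟪a, z⟫ ≤ ⟪u, z⟫) : z - ⟪a, z⟫ • a ∈ innerDual (K : Set E) := by
  refine mem_innerDual.2 fun u hu => ?_
  have hderiv : HasFDerivAt (fun x => ⟪z, x⟫ - ⟪a, z⟫ * ‖x‖)
      (innerSL ℝ z - ⟪a, z⟫ • ‖a‖⁻¹ • innerSL ℝ a) a :=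
    (innerSL ℝ z).hasFDerivAt.sub ((hasFDerivAt_norm (ne_zero_of_mem_unitVectors ha)).const_mul _)
  have hmin' : IsMinOn (fun x => ⟪z, x⟫ - ⟪a, z⟫ * ‖x‖) K a := fun x hx => by
    have := mul_norm_le_inner hmin hx
    simp only [Set.mem_ofPred_eq, ha.2, real_inner_comm z] at this ⊢
    linarith
  have hcone : u ∈ posTangentConeAt (K : Set E) a :=
    mem_posTangentConeAt_of_segment_subset (K.convex.segment_subset ha.1 (K.add_mem ha.1 hu))
  have := hmin'.localize.hasFDerivWithinAt_nonneg hderiv.hasFDerivWithinAt hcone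
  rw [inner_sub_right, real_inner_smul_right]
  simpa [ha.2, real_inner_comm u] using this

lemma arcDirection_mem_innerDual (ha : a ∈ unitVectors K)
    (hmin : ∀ u ∈ unitVectors K, ⟪a, z⟫ ≤ ⟪u, z⟫) :
    arcDirection a z ∈ innerDual (K : Set E) :=
  (innerDual (K : Set E)).smul_mem (sub_inner_smul_mem_innerDual ha hmin) (by positivity)

lemma inner_pos_of_mem_interior {s : Set E} {b : E} (ho : o ∈ interior s)
    (hb : b ∈ innerDual s) (hb0 : b ≠ 0) : 0 < ⟪o, b⟫ := by
  obtain ⟨ε, hε, hmem⟩ := exists_pos_sub_smul_mem ho b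
  have h := mem_innerDual.1 hb hmem
  rw [inner_sub_left, real_inner_smul_left, real_inner_self_eq_norm_sq] at h
  have : 0 < ε * ‖b‖ ^ 2 := by positivity
  linarith

lemma mem_frontier_iff_exists_inner_eq_zero (hK : (interior (K : Set E)).Nonempty) :
    x ∈ frontier (K : Set E) ↔
      x ∈ K ∧ ∃ k ∈ unitVectors (innerDual (K : Set E)), ⟪x, k⟫ = 0 := by
  rw [K.isClosed.frontier_eq, Set.mem_sdiff]
  refine and_congr_right fun hx => ⟨fun hxint => ?_, ?_⟩
  · obtain ⟨f, hf0, hf⟩ := geometric_hahn_banach_of_nonempty_interior_point K.convex hxint hK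
    have hfx : f x = 0 := by
      have h0 := hf 0 K.zero_mem
      have h2 := hf (x + x) (K.add_mem hx hx)
      rw [map_zero] at h0
      rw [map_add] at h2
      linarith
    set k := (InnerProductSpace.toDual ℝ E).symm (-f)
    have hk : ∀ u, ⟪u, k⟫ = -f u := fun u => by
      rw [real_inner_comm, InnerProductSpace.toDual_symm_apply, neg_apply]
    have hkK : k ∈ innerDual (K : Set E) := mem_innerDual.2 fun u hu => by
      have := hf u hu
      rw [hk]
      linarith
    have hk0 : k ≠ 0 := by simpa [k] using hf0
    exact ⟨_, normalize_mem_unitVectors hkK hk0, by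
      rw [NormedSpace.normalize, real_inner_smul_right, hk, hfx, neg_zero, mul_zero]⟩
  · rintro ⟨k, hk, hxk⟩ hxint
    exact (inner_pos_of_mem_interior hxint hk.1 (ne_zero_of_mem_unitVectors hk)).ne' hxk

/-- The closed convex cones that are solid and pointed: they and their duals have interior points.
These are the cones over spherical convex bodies. -/
structure IsRegularCone (K : ProperCone ℝ E) : Prop where
  interior_nonempty : (interior (K : Set E)).Nonempty
  interior_innerDual_nonempty : (interior (innerDual (K : Set E) : Set E)).Nonempty

namespace IsRegularCone

lemma dual (hK : IsRegularCone K) : IsRegularCone (innerDual (K : Set E)) :=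
  ⟨hK.interior_innerDual_nonempty, by simpa using hK.interior_nonempty⟩

lemma neg_notMem (hK : IsRegularCone K) (hx : x ∈ K) (hx0 : x ≠ 0) : -x ∉ K := by
  intro hneg
  obtain ⟨b, hb⟩ := hK.interior_innerDual_nonempty
  have hpos := inner_pos_of_mem_interior hb (by rwa [innerDual_innerDual]) hx0
  have := mem_innerDual.1 (interior_subset hb) hneg
  rw [inner_neg_left, real_inner_comm] at this
  linarith

lemma neg_one_lt_inner (hK : IsRegularCone K) (hx : x ∈ unitVectors K) (hy : y ∈ unitVectors K) :
    -1 < ⟪x, y⟫ := by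
  have hle := abs_le.1 ((abs_real_inner_le_norm x y).trans_eq (by rw [hx.2, hy.2, one_mul]))
  refine hle.1.lt_of_ne' fun h => hK.neg_notMem hy.1 (ne_zero_of_mem_unitVectors hy) ?_
  rw [← (inner_eq_neg_one_iff_of_norm_eq_one (𝕜 := ℝ) hx.2 hy.2).1 h]
  exact hx.1

end IsRegularCone

/-- The unit vectors of `K` form a set of constant diameter `δ`: no two of them make an angle
larger than `δ`, and each one on the boundary of `K`, that is, orthogonal to some unit vector of
the dual cone, makes the angle `δ` with another one. -/
structure HasConstantAngle (K : ProperCone ℝ E) (δ : ℝ) : Prop where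
  cos_le_inner : ∀ x ∈ unitVectors K, ∀ y ∈ unitVectors K, Real.cos δ ≤ ⟪x, y⟫
  exists_inner_eq_cos : ∀ x ∈ unitVectors K, ∀ k ∈ unitVectors (innerDual (K : Set E)),
    ⟪x, k⟫ = 0 → ∃ y ∈ unitVectors K, ⟪x, y⟫ = Real.cos δ

namespace HasConstantAngle

variable {δ : ℝ} {k : E}

lemma mem_of_forall_mul_norm_le_inner (h : HasConstantAngle K δ)
    (hK : (interior (K : Set E)).Nonempty) (hcos : 0 ≤ Real.cos δ) (hcos1 : Real.cos δ < 1)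
    (hz : ∀ v ∈ unitVectors K, Real.cos δ * ‖z‖ ≤ ⟪z, v⟫) : z ∈ K := by
  by_contra hzK
  obtain ⟨o, ho⟩ := hK
  obtain ⟨p, ⟨α, β, hα, hβ, hαβ, rfl⟩, hp⟩ := nonempty_inter_frontier
    (convex_segment z o).isPreconnected (s := (K : Set E))
    ⟨o, right_mem_segment ℝ z o, interior_subset ho⟩ ⟨z, left_mem_segment ℝ z o, hzK⟩
  obtain ⟨hpK, k, hk, hpk⟩ := (mem_frontier_iff_exists_inner_eq_zero ⟨o, ho⟩).1 hp
  have hβ : 0 < β := hβ.lt_of_ne fun h0 => hzK <| by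
    obtain rfl : α = 1 := by linarith
    simpa [← h0] using hpK
  set p := α • z + β • o
  have hlt : ∀ v ∈ unitVectors K, Real.cos δ * ‖p‖ < ⟪p, v⟫ := fun v hv => by
    have hov := mul_norm_lt_inner_of_mem_interior (abs_lt.2 ⟨by linarith, hcos1⟩) ho hv.2
      fun u hu => h.cos_le_inner u hu v hv
    calc Real.cos δ * ‖p‖ ≤ Real.cos δ * (α * ‖z‖ + β * ‖o‖) := by
          gcongr
          simpa [norm_smul, abs_of_nonneg, hα, hβ.le] using norm_add_le (α • z) (β • o)
      _ = α * (Real.cos δ * ‖z‖) + β * (Real.cos δ * ‖o‖) := by ring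
      _ < α * ⟪z, v⟫ + β * ⟪o, v⟫ :=
          add_lt_add_of_le_of_lt (mul_le_mul_of_nonneg_left (hz v hv) hα)
            (mul_lt_mul_of_pos_left hov hβ)
      _ = ⟪p, v⟫ := by simp [p, inner_add_left, real_inner_smul_left]
  have ho0 : o ≠ 0 := by
    rintro rfl
    simpa using inner_pos_of_mem_interior ho hk.1 (ne_zero_of_mem_unitVectors hk)
  have hp0 : p ≠ 0 := fun h0 => by
    simpa [h0] using hlt _ (normalize_mem_unitVectors (interior_subset ho) ho0)
  obtain ⟨y, hy, hpy⟩ := h.exists_inner_eq_cos _ (normalize_mem_unitVectors hpK hp0) k hk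
    (by rw [NormedSpace.normalize, real_inner_smul_left, hpk, mul_zero])
  refine (hlt y hy).ne ?_
  rw [← hpy, mul_comm, ← real_inner_smul_left, NormedSpace.norm_smul_normalize]

lemma exists_pos_add_smul_mem {η : ℝ} {t : E} (h : HasConstantAngle K δ)
    (hK : (interior (K : Set E)).Nonempty) (hcos : 0 ≤ Real.cos δ) (hcos1 : Real.cos δ < 1)
    (hx : x ∈ unitVectors K) (hη : 0 < η)
    (ht : ∀ v ∈ unitVectors K, Real.cos δ * ⟪x, t⟫ + η ≤ ⟪t, v⟫) :
    ∃ ε : ℝ, 0 < ε ∧ x + ε • t ∈ K := by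
  set c := Real.cos δ
  set ε := η / (c * ‖t‖ ^ 2 + 1)
  have hε : 0 < ε := by positivity
  have hεη : c * ‖t‖ ^ 2 * ε ≤ η := by
    rw [mul_div_assoc', div_le_iff₀ (by positivity)]
    nlinarith
  refine ⟨ε, hε, h.mem_of_forall_mul_norm_le_inner hK hcos hcos1 fun v hv => ?_⟩
  calc c * ‖x + ε • t‖ ≤ c * (1 + ε * ⟪x, t⟫ + ε ^ 2 * ‖t‖ ^ 2 / 2) := by
        gcongr
        exact norm_add_smul_le hx.2 ε t
    _ = c + ε * (c * ⟪x, t⟫ + c * ‖t‖ ^ 2 * ε / 2) := by ring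
    _ ≤ ⟪x, v⟫ + ε * ⟪t, v⟫ := by
        gcongr
        · exact h.cos_le_inner x hx v hv
        · linarith [ht v hv]
    _ = ⟪x + ε • t, v⟫ := by rw [inner_add_left, real_inner_smul_left]

lemma cos_smul_add_sin_smul_mem_of_cos_nonneg (h : HasConstantAngle K δ)
    (hK : (interior (K : Set E)).Nonempty) (hδ : δ ∈ Set.Ioo 0 Real.pi) (hcos : 0 ≤ Real.cos δ)
    (hx : x ∈ unitVectors K) (hk : k ∈ unitVectors (innerDual (K : Set E))) (hxk : ⟪x, k⟫ = 0) :
    Real.cos δ • x + Real.sin δ • k ∈ K := by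
  have hs : 0 < Real.sin δ := Real.sin_pos_of_mem_Ioo hδ
  have hcs := Real.cos_sq_add_sin_sq δ
  have hcos1 : Real.cos δ < 1 := by nlinarith
  by_contra hy
  obtain ⟨a, ha, hay⟩ : ∃ a ∈ unitVectors K,
      Real.cos δ * ⟪x, a⟫ + Real.sin δ * ⟪k, a⟫ < Real.cos δ := by
    by_contra! hall
    refine hy (h.mem_of_forall_mul_norm_le_inner hK hcos hcos1 fun v hv => ?_)
    rw [norm_cos_smul_add_sin_smul hx.2 hk.2 hxk, mul_one, inner_add_left, real_inner_smul_left,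
      real_inner_smul_left]
    exact hall v hv
  have hka : 0 ≤ ⟪k, a⟫ := by
    rw [real_inner_comm]
    exact mem_innerDual.1 hk.1 ha.1
  -- Moving `x` in the direction `a - r • k` stays in `K` but leaves the half-space dual to `k`.
  obtain ⟨r, hkr, hr⟩ := exists_between (show ⟪k, a⟫ < Real.cos δ * (1 - ⟪x, a⟫) / Real.sin δ by
    rw [lt_div_iff₀ hs]
    linarith)
  rw [lt_div_iff₀ hs] at hr
  obtain ⟨ε, hε, hmem⟩ := h.exists_pos_add_smul_mem hK hcos hcos1 hx (sub_pos.2 hr)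
    (t := a - r • k) fun v hv => by
      have hxv := h.cos_le_inner x hx v hv
      have hav := h.cos_le_inner a ha v hv
      have hkv : ⟪k, v⟫ ≤ Real.sin δ := inner_le_of_sq_le_sq_inner hx.2 hk.2 hxk
        hv.2 hcs hs.le (by gcongr)
      simp only [inner_sub_left, inner_sub_right, real_inner_smul_left, real_inner_smul_right, hxk]
      linarith [mul_le_mul_of_nonneg_left hkv (hka.trans hkr.le)]
  have hnonneg := mem_innerDual.1 hk.1 hmem
  rw [inner_add_left, real_inner_smul_left, inner_sub_left, real_inner_smul_left, hxk,
    real_inner_comm, real_inner_self_eq_norm_sq, hk.2] at hnonneg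
  nlinarith

end HasConstantAngle

end Cones

section FiniteDimensional

variable {E : Type*} [NormedAddCommGroup E] [InnerProductSpace ℝ E] [FiniteDimensional ℝ E]
  {K : ProperCone ℝ E}

lemma interior_innerDual_nonempty_of_forall_neg_notMem
    (h : ∀ x ∈ K, x ≠ 0 → -x ∉ K) : (interior (innerDual (K : Set E) : Set E)).Nonempty := by
  set D := innerDual (K : Set E)
  have hspan : Submodule.span ℝ (D : Set E) = ⊤ := by
    refine Submodule.orthogonal_eq_bot_iff.1 ((Submodule.eq_bot_iff _).2 fun v hv => ?_)
    have hzero : ∀ k ∈ D, ⟪k, v⟫ = 0 := fun k hk => hv k (Submodule.subset_span hk)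
    by_contra hv0
    refine h v ?_ hv0 ?_ <;> rw [← innerDual_innerDual K, mem_innerDual] <;> intro k hk
    · exact (hzero k hk).ge
    · rw [inner_neg_right, hzero k hk, neg_zero]
  rw [D.convex.interior_nonempty_iff_affineSpan_eq_top,
    AffineSubspace.affineSpan_eq_top_iff_vectorSpan_eq_top_of_nonempty _ _ _ D.nonempty,
    vectorSpan_eq_span_vsub_set_right ℝ (s := (D : Set E)) D.zero_mem]
  simpa using hspan

lemma le_inner_of_forall_arcDirection_mem {c : ℝ} (hc : c ≤ 1)
    (h : ∀ k ∈ unitVectors K, ∀ k' ∈ unitVectors K, k ≠ k' →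
      arcDirection k k' ∈ innerDual (K : Set E) → arcDirection k' k ∈ innerDual (K : Set E) →
      c ≤ ⟪k, k'⟫) :
    ∀ x ∈ unitVectors K, ∀ y ∈ unitVectors K, c ≤ ⟪x, y⟫ := by
  intro x hx y hy
  have hcompact : IsCompact (unitVectors K) := by
    refine (isCompact_sphere (0 : E) 1).of_isClosed_subset
      (K.isClosed.inter (isClosed_eq continuous_norm continuous_const)) fun x hx => ?_
    simpa using hx.2
  obtain ⟨⟨k, k'⟩, ⟨hk, hk'⟩, hmin⟩ := (hcompact.prod hcompact).exists_isMinOn ⟨(x, y), hx, hy⟩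
    (f := fun p => ⟪p.1, p.2⟫) (by fun_prop)
  have hmin : ∀ u ∈ unitVectors K, ∀ v ∈ unitVectors K, ⟪k, k'⟫ ≤ ⟪u, v⟫ :=
    fun u hu v hv => hmin (Set.mk_mem_prod hu hv)
  refine le_trans ?_ (hmin x hx y hy)
  rcases eq_or_ne k k' with rfl | hne
  · rwa [real_inner_self_eq_norm_sq, hk.2, one_pow]
  · refine h k hk k' hk' hne (arcDirection_mem_innerDual hk fun u hu => hmin u hu k' hk')
      (arcDirection_mem_innerDual hk' fun u hu => ?_)
    rw [real_inner_comm, real_inner_comm k]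
    exact hmin k hk u hu

lemma neg_cos_le_of_nonneg {δ t : ℝ} (hδ : δ ∈ Set.Ioo 0 Real.pi) (ht : t ∈ Set.Icc (-1) 1)
    (h : 0 ≤ t * Real.sin δ + √(1 - t ^ 2) * Real.cos δ) : -Real.cos δ ≤ t := by
  set τ := Real.arccos t with hτ
  have hcos : t = Real.cos τ := (Real.cos_arccos ht.1 ht.2).symm
  rw [← Real.sin_arccos, ← hτ, hcos] at h
  have hsin : 0 ≤ Real.sin (δ + τ) := by
    rw [Real.sin_add]
    linarith
  have hle : δ + τ ≤ Real.pi := by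
    by_contra! hlt
    have := Real.sin_pos_of_pos_of_lt_pi (x := δ + τ - Real.pi) (by linarith)
      (by linarith [hδ.2, Real.arccos_le_pi t])
    rw [Real.sin_sub_pi] at this
    linarith
  rw [← Real.cos_pi_sub, hcos]
  exact Real.cos_le_cos_of_nonneg_of_le_pi (Real.arccos_nonneg t) (by linarith [hδ.1])
    (by linarith)

namespace HasConstantAngle

variable {δ : ℝ} {x k k' : E}

lemma neg_cos_le_inner (h : HasConstantAngle K δ) (hK : IsRegularCone K)
    (hδ : δ ∈ Set.Ioo 0 Real.pi) (hk : k ∈ unitVectors (innerDual (K : Set E)))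
    (hk' : k' ∈ unitVectors (innerDual (K : Set E))) : -Real.cos δ ≤ ⟪k, k'⟫ := by
  refine le_inner_of_forall_arcDirection_mem (by linarith [Real.neg_one_le_cos δ])
    (fun k hk k' hk' hne hx _ => ?_) k hk k' hk'
  have ht : ⟪k, k'⟫ ∈ Set.Ioo (-1) 1 :=
    ⟨hK.dual.neg_one_lt_inner hk hk', (inner_lt_one_iff_real_of_norm_eq_one hk.2 hk'.2).2 hne⟩
  rw [innerDual_innerDual] at hx
  set x := arcDirection k k'
  have hxu : x ∈ unitVectors K := ⟨hx, norm_arcDirection hk.2 hk'.2 ht⟩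
  have hxk : ⟪x, k⟫ = 0 := by rw [real_inner_comm, inner_arcDirection_left hk.2]
  have hk'x : k' = ⟪k, k'⟫ • k + √(1 - ⟪k, k'⟫ ^ 2) • x := by
    rw [sqrt_smul_arcDirection ht, add_sub_cancel]
  have hnonneg : ∀ y ∈ unitVectors K, ⟪x, y⟫ = Real.cos δ →
      0 ≤ ⟪k, k'⟫ * ⟪k, y⟫ + √(1 - ⟪k, k'⟫ ^ 2) * Real.cos δ := fun y hy hxy => by
    have := mem_innerDual.1 hk'.1 hy.1
    rwa [hk'x, inner_add_right, real_inner_smul_right, real_inner_smul_right, real_inner_comm k,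
      real_inner_comm x, hxy] at this
  have hs : 0 < Real.sin δ := Real.sin_pos_of_mem_Ioo hδ
  refine neg_cos_le_of_nonneg hδ (Set.Ioo_subset_Icc_self ht) ?_
  rcases le_or_gt 0 (Real.cos δ) with hcos | hcos
  · have hy := h.cos_smul_add_sin_smul_mem_of_cos_nonneg hK.interior_nonempty hδ hcos hxu hk hxk
    have := hnonneg _ ⟨hy, norm_cos_smul_add_sin_smul hxu.2 hk.2 hxk δ⟩ (by
      simp [inner_add_right, real_inner_smul_right, hxu.2, hxk])
    simpa [inner_add_right, real_inner_smul_right, hk.2, real_inner_comm x, hxk] using this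
  · obtain ⟨y, hy, hxy⟩ := h.exists_inner_eq_cos x hxu k hk hxk
    have hky : ⟪k, y⟫ ≤ Real.sin δ := inner_le_of_sq_le_sq_inner hxu.2 hk.2 hxk hy.2
      (Real.cos_sq_add_sin_sq δ) hs.le (by rw [hxy])
    have hky0 : 0 ≤ ⟪k, y⟫ := by
      rw [real_inner_comm]
      exact mem_innerDual.1 hk.1 hy.1
    have hsum := hnonneg y hy hxy
    have hneg : √(1 - ⟪k, k'⟫ ^ 2) * Real.cos δ < 0 :=
      mul_neg_of_pos_of_neg (Real.sqrt_pos.2 (by nlinarith [ht.1, ht.2])) hcos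
    have hkk' : 0 < ⟪k, k'⟫ := pos_of_mul_pos_left (b := ⟪k, y⟫) (by linarith) hky0
    linarith [mul_le_mul_of_nonneg_left hky hkk'.le]

lemma cos_smul_add_sin_smul_mem (h : HasConstantAngle K δ) (hK : IsRegularCone K)
    (hδ : δ ∈ Set.Ioo 0 Real.pi) (hx : x ∈ unitVectors K)
    (hk : k ∈ unitVectors (innerDual (K : Set E))) (hxk : ⟪x, k⟫ = 0) :
    Real.cos δ • x + Real.sin δ • k ∈ K := by
  rcases le_or_gt 0 (Real.cos δ) with hcos | hcos
  · exact h.cos_smul_add_sin_smul_mem_of_cos_nonneg hK.interior_nonempty hδ hcos hx hk hxk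
  have hs : 0 < Real.sin δ := Real.sin_pos_of_mem_Ioo hδ
  have hcs := Real.cos_sq_add_sin_sq δ
  obtain ⟨q, hq, hxq⟩ := h.exists_inner_eq_cos x hx k hk hxk
  have hqx : ⟪q, x⟫ = Real.cos δ := by rw [real_inner_comm, hxq]
  have hd : arcDirection q x ∈ unitVectors (innerDual (K : Set E)) :=
    ⟨arcDirection_mem_innerDual hq fun u hu => hqx.trans_le (h.cos_le_inner u hu x hx),
      norm_arcDirection hq.2 hx.2 (by rw [hqx]; constructor <;> nlinarith)⟩
  have hkd : ⟪k, arcDirection q x⟫ = -Real.cos δ * ⟪q, k⟫ / Real.sin δ := by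
    rw [arcDirection, hqx, ← Real.sin_eq_sqrt_one_sub_cos_sq hδ.1.le hδ.2.le, real_inner_smul_right,
      inner_sub_right, real_inner_smul_right, real_inner_comm, hxk, real_inner_comm q]
    ring
  have hqk : Real.sin δ ≤ ⟪q, k⟫ := by
    have := h.neg_cos_le_inner hK hδ hk hd
    rw [hkd, le_div_iff₀ hs] at this
    exact le_of_mul_le_mul_left this (by linarith)
  have hy := norm_cos_smul_add_sin_smul hx.2 hk.2 hxk δ
  suffices q = Real.cos δ • x + Real.sin δ • k from this ▸ hq.1
  refine (inner_eq_one_iff_of_norm_eq_one (𝕜 := ℝ) hq.2 hy).1 (le_antisymm ?_ ?_)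
  · simpa [hq.2, hy] using real_inner_le_norm q (Real.cos δ • x + Real.sin δ • k)
  · rw [inner_add_right, real_inner_smul_right, real_inner_smul_right, hqx]
    nlinarith

theorem dual (h : HasConstantAngle K δ) (hK : IsRegularCone K) (hδ : δ ∈ Set.Ioo 0 Real.pi) :
    HasConstantAngle (innerDual (K : Set E)) (Real.pi - δ) where
  cos_le_inner k hk k' hk' := by
    rw [Real.cos_pi_sub]
    exact h.neg_cos_le_inner hK hδ hk hk'
  exists_inner_eq_cos k hk x hx hkx := by
    rw [innerDual_innerDual] at hx
    have hxk : ⟪x, k⟫ = 0 := by rwa [real_inner_comm]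
    have hs : 0 < Real.sin δ := Real.sin_pos_of_mem_Ioo hδ
    have hcs := Real.cos_sq_add_sin_sq δ
    set y := Real.cos δ • x + Real.sin δ • k
    have hy : y ∈ unitVectors K :=
      ⟨h.cos_smul_add_sin_smul_mem hK hδ hx hk hxk, norm_cos_smul_add_sin_smul hx.2 hk.2 hxk δ⟩
    have hyx : ⟪y, x⟫ = Real.cos δ := by
      simp [y, inner_add_left, real_inner_smul_left, hx.2, hkx]
    have hky : ⟪k, y⟫ = Real.sin δ := by
      simp [y, inner_add_right, real_inner_smul_right, hk.2, hkx]
    refine ⟨arcDirection y x,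
      ⟨arcDirection_mem_innerDual hy fun u hu => hyx.trans_le (h.cos_le_inner u hu x hx),
        norm_arcDirection hy.2 hx.2 (by rw [hyx]; constructor <;> nlinarith)⟩, ?_⟩
    rw [arcDirection, hyx, ← Real.sin_eq_sqrt_one_sub_cos_sq hδ.1.le hδ.2.le, real_inner_smul_right,
      inner_sub_right, real_inner_smul_right, hkx, hky, Real.cos_pi_sub]
    field_simp
    ring

end HasConstantAngle

theorem hasConstantAngle_innerDual_iff {δ : ℝ} (hK : IsRegularCone K)
    (hδ : δ ∈ Set.Ioo 0 Real.pi) :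
    HasConstantAngle (innerDual (K : Set E)) (Real.pi - δ) ↔ HasConstantAngle K δ := by
  refine ⟨fun h => ?_, fun h => h.dual hK hδ⟩
  simpa using h.dual hK.dual ⟨by linarith [hδ.2], by linarith [hδ.1]⟩

end FiniteDimensional

section Sphere

variable {E : Type*} [NormedAddCommGroup E] [InnerProductSpace ℝ E] {K : ProperCone ℝ E}

lemma mem_interior_preimage_coe_iff {a : Metric.sphere (0 : E) 1} :
    a ∈ interior (Subtype.val ⁻¹' (K : Set E) : Set (Metric.sphere (0 : E) 1)) ↔
      (a : E) ∈ interior (K : Set E) := by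
  refine ⟨fun ha => ?_, fun ha =>
    preimage_interior_subset_interior_preimage continuous_subtype_val ha⟩
  have ha1 : ‖(a : E)‖ = 1 := norm_eq_of_mem_sphere a
  obtain ⟨u, hu, hsub⟩ := (mem_nhds_subtype _ _ _).1 (mem_interior_iff_mem_nhds.1 ha)
  have hcont : ContinuousAt (NormedSpace.normalize : E → E) a :=
    (continuous_norm.continuousAt.inv₀ (by simp [ha1])).smul continuousAt_id
  rw [mem_interior_iff_mem_nhds]
  filter_upwards [hcont.preimage_mem_nhds (by simpa [NormedSpace.normalize, ha1] using hu),
    continuous_norm.continuousAt.eventually_ne (by simp [ha1] : ‖(a : E)‖ ≠ 0)] with y hyu hy0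
  have hmem : NormedSpace.normalize y ∈ K :=
    @hsub ⟨_, mem_sphere_zero_iff_norm.2 (NormedSpace.norm_normalize_eq_one_iff.2
      (norm_ne_zero_iff.1 hy0))⟩ hyu
  rw [← NormedSpace.norm_smul_normalize y]
  exact K.smul_mem hmem (norm_nonneg y)

lemma mem_frontier_preimage_coe_iff {a : Metric.sphere (0 : E) 1} :
    a ∈ frontier (Subtype.val ⁻¹' (K : Set E) : Set (Metric.sphere (0 : E) 1)) ↔
      (a : E) ∈ frontier (K : Set E) := by
  rw [(K.isClosed.preimage continuous_subtype_val).frontier_eq, K.isClosed.frontier_eq,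
    Set.mem_sdiff, Set.mem_sdiff, mem_interior_preimage_coe_iff, Set.mem_preimage]

lemma mem_frontier_innerDual_singleton [CompleteSpace E] {m x : E} (hm : m ≠ 0) :
    x ∈ frontier (innerDual {m} : Set E) ↔ ⟪m, x⟫ = 0 := by
  have hsurj : Function.Surjective (innerSL ℝ m) :=
    LinearMap.surjective (f := (innerSL ℝ m).toLinearMap) fun h0 => hm <| by
      simpa using LinearMap.congr_fun h0 m
  have hpre : (innerDual {m} : Set E) = innerSL ℝ m ⁻¹' Set.Ici 0 := by
    ext
    simp
  rw [hpre, ContinuousLinearMap.frontier_preimage _ hsurj]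
  simp

variable {d : ℕ} {a b g h k m x : Sph d} {w : ℝ} {W : Set (Sph d)}

lemma norm_coe (a : Sph d) : ‖a.1‖ = 1 := norm_eq_of_mem_sphere a

lemma sdist_eq_arccos (a b : Sph d) : sdist a b = Real.arccos ⟪a.1, b.1⟫ := by
  rw [sdist, InnerProductGeometry.angle, norm_coe, norm_coe, mul_one, div_one]

lemma cos_sdist (a b : Sph d) : Real.cos (sdist a b) = ⟪a.1, b.1⟫ := by
  rw [sdist, InnerProductGeometry.cos_angle, norm_coe, norm_coe, mul_one, div_one]

lemma sdist_self (a : Sph d) : sdist a a = 0 :=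
  InnerProductGeometry.angle_self (norm_ne_zero_iff.1 (by simp))

lemma sdist_mem_Icc (a b : Sph d) : sdist a b ∈ Set.Icc 0 Real.pi :=
  ⟨InnerProductGeometry.angle_nonneg _ _, InnerProductGeometry.angle_le_pi _ _⟩

lemma inner_mem_Ioo (h : a ≠ b) (h' : a ≠ -b) : ⟪a.1, b.1⟫ ∈ Set.Ioo (-1) 1 :=
  inner_mem_Ioo_of_norm_eq_one (norm_coe a) (norm_coe b) (Subtype.coe_ne_coe.2 h)
    fun h0 => h' (Subtype.ext h0)

lemma sdist_mem_Ioo (h : a ≠ b) (h' : a ≠ -b) : sdist a b ∈ Set.Ioo 0 Real.pi := by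
  obtain ⟨hlt, hgt⟩ := inner_mem_Ioo h h'
  rw [sdist_eq_arccos]
  exact ⟨Real.arccos_pos.2 hgt, by
    rw [← Real.arccos_neg_one]; exact Real.arccos_lt_arccos le_rfl hlt hgt.le⟩

lemma sdist_le_iff (hw : w ∈ Set.Icc 0 Real.pi) : sdist a b ≤ w ↔ Real.cos w ≤ ⟪a.1, b.1⟫ := by
  rw [← cos_sdist]
  exact (Real.strictAntiOn_cos.le_iff_ge hw (sdist_mem_Icc a b)).symm

lemma sdist_eq_iff (hw : w ∈ Set.Icc 0 Real.pi) : sdist a b = w ↔ ⟪a.1, b.1⟫ = Real.cos w := by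
  rw [← cos_sdist]
  exact (Real.injOn_cos.eq_iff (sdist_mem_Icc a b) hw).symm

lemma hemisphere_eq_preimage_innerDual (m : Sph d) :
    hemisphere m = Subtype.val ⁻¹' (innerDual {m.1} : Set (EuclideanSpace ℝ (Fin (d + 1)))) := by
  ext x
  change sdist m x ≤ Real.pi / 2 ↔ _
  rw [sdist_eq_arccos, Real.arccos_le_pi_div_two]
  simp

lemma mem_hemisphere : x ∈ hemisphere m ↔ 0 ≤ ⟪m.1, x.1⟫ := by
  simp [hemisphere_eq_preimage_innerDual]

lemma mem_frontier_hemisphere : x ∈ frontier (hemisphere m) ↔ ⟪m.1, x.1⟫ = 0 := by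
  rw [hemisphere_eq_preimage_innerDual, mem_frontier_preimage_coe_iff,
    mem_frontier_innerDual_singleton (norm_ne_zero_iff.1 (by simp))]

lemma isFaceCenter_iff {c : Sph d} (hgh : ⟪g.1, h.1⟫ ∈ Set.Ioo (-1) 1) :
    IsFaceCenter g h c ↔ c.1 = arcDirection g.1 h.1 := by
  have hface : luneFace g h = {x | x ∈ frontier (hemisphere g) ∧ sdist c x ≤ Real.pi / 2} ↔
      ∀ x : Sph d, ⟪g.1, x.1⟫ = 0 → (0 ≤ ⟪arcDirection g.1 h.1, x.1⟫ ↔ 0 ≤ ⟪c.1, x.1⟫) := by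
    rw [Set.ext_iff]
    refine forall_congr' fun x => ?_
    change (x ∈ _ ∧ x ∈ hemisphere h ↔ x ∈ _ ∧ x ∈ hemisphere c) ↔ _
    rw [mem_frontier_hemisphere, mem_hemisphere, mem_hemisphere, and_congr_right_iff]
    exact forall_congr' fun hx => by rw [inner_arcDirection_nonneg_iff hgh hx]
  rw [IsFaceCenter, mem_frontier_hemisphere, hface]
  constructor
  · rintro ⟨hgc, hiff⟩
    exact (eq_of_forall_inner_nonneg (norm_arcDirection (norm_coe g) (norm_coe h) hgh)
      (norm_coe c) (inner_arcDirection_left (norm_coe g) _) hgc fun x hx hgx =>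
        (hiff ⟨x, mem_sphere_zero_iff_norm.2 hx⟩ hgx).1).symm
  · intro hc
    rw [hc]
    exact ⟨inner_arcDirection_left (norm_coe g) _, fun x _ => Iff.rfl⟩

lemma isLuneThickness_iff {t : ℝ} :
    IsLuneThickness g h t ↔ g ≠ h ∧ g ≠ -h ∧ t = Real.pi - sdist g h := by
  refine and_congr_right fun hne => and_congr_right fun hne' => ?_
  have hgh := inner_mem_Ioo hne hne'
  have hhg : ⟪h.1, g.1⟫ ∈ Set.Ioo (-1) 1 := by rwa [real_inner_comm]
  have hsdist : ∀ c c' : Sph d, c.1 = arcDirection g.1 h.1 → c'.1 = arcDirection h.1 g.1 →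
      sdist c c' = Real.pi - sdist g h := fun c c' hc hc' => by
    rw [sdist_eq_arccos, sdist_eq_arccos, ← Real.arccos_neg, hc, hc',
      inner_arcDirection_arcDirection (norm_coe g) (norm_coe h) hgh]
  simp only [isFaceCenter_iff hgh, isFaceCenter_iff hhg]
  constructor
  · rintro ⟨c, c', hc, hc', rfl⟩
    exact hsdist c c' hc hc'
  · rintro rfl
    exact ⟨⟨_, mem_sphere_zero_iff_norm.2 (norm_arcDirection (norm_coe g) (norm_coe h) hgh)⟩,
      ⟨_, mem_sphere_zero_iff_norm.2 (norm_arcDirection (norm_coe h) (norm_coe g) hhg)⟩, rfl, rfl,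
      (hsdist _ _ rfl rfl).symm⟩

lemma IsWidth.mem_Ioo (hk : IsWidth k W w) : w ∈ Set.Ioo 0 Real.pi := by
  obtain ⟨⟨m, -, hm⟩, -⟩ := hk
  obtain ⟨hne, hne', rfl⟩ := isLuneThickness_iff.1 hm
  obtain ⟨hpos, hlt⟩ := sdist_mem_Ioo hne hne'
  exact ⟨sub_pos.2 hlt, sub_lt_self _ hpos⟩

/-- The closed spherically convex set that the cone `K` cuts out of `S^d`: the set `unitVectors K`
as a subset of `Sph d`. -/
def sphericalTrace (K : ProperCone ℝ (EuclideanSpace ℝ (Fin (d + 1)))) : Set (Sph d) :=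
  Subtype.val ⁻¹' K

variable {K : ProperCone ℝ (EuclideanSpace ℝ (Fin (d + 1)))}

lemma mem_sphericalTrace : a ∈ sphericalTrace K ↔ a.1 ∈ unitVectors K :=
  ⟨fun ha => ⟨ha, norm_coe a⟩, fun ha => ha.1⟩

lemma sphericalTrace_subset_hemisphere_iff :
    sphericalTrace K ⊆ hemisphere m ↔ m.1 ∈ unitVectors (innerDual (SetLike.coe K)) := by
  refine ⟨fun hm => ⟨mem_innerDual.2 fun x hx => ?_, norm_coe m⟩, fun hm a ha => ?_⟩
  · rcases eq_or_ne x 0 with rfl | hx0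
    · simp
    · have hmem := normalize_mem_unitVectors hx hx0
      have := mem_hemisphere.1 (@hm ⟨_, mem_sphere_zero_iff_norm.2 hmem.2⟩ hmem.1)
      rw [← NormedSpace.norm_smul_normalize x, real_inner_smul_left, real_inner_comm]
      exact mul_nonneg (norm_nonneg x) this
  · rw [mem_hemisphere, real_inner_comm]
    exact mem_innerDual.1 hm.1 ha

lemma mem_frontier_sphericalTrace_iff (hK : (interior (SetLike.coe K)).Nonempty) :
    a ∈ frontier (sphericalTrace K) ↔
      a.1 ∈ unitVectors K ∧ ∃ k ∈ unitVectors (innerDual (SetLike.coe K)), ⟪a.1, k⟫ = 0 := by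
  rw [sphericalTrace, mem_frontier_preimage_coe_iff, mem_frontier_iff_exists_inner_eq_zero hK,
    ← mem_sphericalTrace]
  rfl

lemma supports_sphericalTrace_iff (hK : (interior (SetLike.coe K)).Nonempty) :
    Supports m (sphericalTrace K) ↔ m.1 ∈ unitVectors (innerDual (SetLike.coe K)) ∧
      ∃ x ∈ unitVectors K, ⟪m.1, x⟫ = 0 := by
  rw [Supports, sphericalTrace_subset_hemisphere_iff]
  refine and_congr_right fun hm => ⟨?_, ?_⟩
  · rintro ⟨a, haK, ham⟩
    exact ⟨a.1, ((mem_frontier_sphericalTrace_iff hK).1 haK).1, mem_frontier_hemisphere.1 ham⟩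
  · rintro ⟨x, hx, hmx⟩
    lift x to Sph d using mem_sphere_zero_iff_norm.2 hx.2
    exact ⟨x, (mem_frontier_sphericalTrace_iff hK).2 ⟨hx, m.1, hm, by rwa [real_inner_comm]⟩,
      mem_frontier_hemisphere.2 hmx⟩

namespace IsRegularCone

lemma exists_mem_sphericalTrace_ne (hK : IsRegularCone K) (ha : a ∈ frontier (sphericalTrace K)) :
    ∃ b ∈ sphericalTrace K, b ≠ a := by
  obtain ⟨-, k, hk, hak⟩ := (mem_frontier_sphericalTrace_iff hK.interior_nonempty).1 ha
  obtain ⟨o, ho⟩ := hK.interior_nonempty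
  have hok := inner_pos_of_mem_interior ho hk.1 (ne_zero_of_mem_unitVectors hk)
  have ho0 : o ≠ 0 := fun h0 => by simp [h0] at hok
  have hmem := normalize_mem_unitVectors (interior_subset ho) ho0
  refine ⟨⟨_, mem_sphere_zero_iff_norm.2 hmem.2⟩, hmem.1, fun h0 => ?_⟩
  have hnormalize : ⟪NormedSpace.normalize o, k⟫ = 0 := by rwa [← h0] at hak
  rw [NormedSpace.normalize, real_inner_smul_left] at hnormalize
  exact (mul_pos (inv_pos.2 (norm_pos_iff.2 ho0)) hok).ne' hnormalize

lemma mem_Ioo_of_isOfConstantDiameter (hK : IsRegularCone K)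
    (hfr : (frontier (sphericalTrace K)).Nonempty)
    (h : IsOfConstantDiameter (sphericalTrace K) w) : w ∈ Set.Ioo 0 Real.pi := by
  obtain ⟨p, hp⟩ := hfr
  obtain ⟨b, hb, hbp⟩ := hK.exists_mem_sphericalTrace_ne hp
  have hpK := ((mem_frontier_sphericalTrace_iff hK.interior_nonempty).1 hp).1
  have hne_neg : ∀ q ∈ sphericalTrace K, p ≠ -q := by
    rintro q hq rfl
    exact hK.neg_notMem hq (ne_zero_of_mem_unitVectors (mem_sphericalTrace.1 hq)) hpK.1
  obtain ⟨q, hq, rfl⟩ := h.2 p hp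
  have hpos : 0 < sdist p q :=
    (sdist_mem_Ioo hbp.symm (hne_neg b hb)).1.trans_le (h.1.1 ⟨p, hpK.1, b, hb, rfl⟩)
  refine sdist_mem_Ioo ?_ (hne_neg q hq)
  rintro rfl
  exact hpos.ne' (sdist_self p)

lemma isOfConstantDiameter_iff (hK : IsRegularCone K)
    (hfr : (frontier (sphericalTrace K)).Nonempty) :
    IsOfConstantDiameter (sphericalTrace K) w ↔
      w ∈ Set.Ioo 0 Real.pi ∧ HasConstantAngle K w := by
  have hfrontier := fun a : Sph d => mem_frontier_sphericalTrace_iff (a := a) hK.interior_nonempty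
  constructor
  · intro h
    have hw := hK.mem_Ioo_of_isOfConstantDiameter hfr h
    have hwI := Set.Ioo_subset_Icc_self hw
    refine ⟨hw, ⟨fun x hx y hy => ?_, fun x hx k hk hxk => ?_⟩⟩ <;>
      lift x to Sph d using mem_sphere_zero_iff_norm.2 hx.2
    · lift y to Sph d using mem_sphere_zero_iff_norm.2 hy.2
      exact (sdist_le_iff hwI).1 (h.1.1 ⟨x, hx.1, y, hy.1, rfl⟩)
    · obtain ⟨q, hq, hxq⟩ := h.2 x ((hfrontier x).2 ⟨hx, k, hk, hxk⟩)
      exact ⟨q.1, mem_sphericalTrace.1 hq, (sdist_eq_iff hwI).1 hxq⟩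
  · rintro ⟨hw, h⟩
    have hwI := Set.Ioo_subset_Icc_self hw
    have hattained : ∀ p ∈ frontier (sphericalTrace K), ∃ q ∈ sphericalTrace K, sdist p q = w :=
      fun p hp => by
        obtain ⟨hpK, k, hk, hpk⟩ := (hfrontier p).1 hp
        obtain ⟨q, hq, hpq⟩ := h.exists_inner_eq_cos p.1 hpK k hk hpk
        lift q to Sph d using mem_sphere_zero_iff_norm.2 hq.2
        exact ⟨q, hq.1, (sdist_eq_iff hwI).2 hpq⟩
    refine ⟨IsGreatest.isLUB ⟨?_, ?_⟩, hattained⟩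
    · obtain ⟨p, hp⟩ := hfr
      obtain ⟨q, hq, hpq⟩ := hattained p hp
      exact ⟨p, ((hfrontier p).1 hp).1.1, q, hq, hpq.symm⟩
    · rintro _ ⟨p, hp, q, hq, rfl⟩
      exact (sdist_le_iff hwI).2
        (h.cos_le_inner _ (mem_sphericalTrace.1 hp) _ (mem_sphericalTrace.1 hq))

lemma hasConstantAngle_innerDual_of_isOfConstantWidth (hK : IsRegularCone K)
    (hw : w ∈ Set.Ioo 0 Real.pi) (h : IsOfConstantWidth (sphericalTrace K) w) :
    HasConstantAngle (innerDual (SetLike.coe K)) (Real.pi - w) := by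
  have hsupports := fun m : Sph d => supports_sphericalTrace_iff (m := m) hK.interior_nonempty
  have hwI : Real.pi - w ∈ Set.Icc 0 Real.pi := ⟨by linarith [hw.2], by linarith [hw.1]⟩
  constructor
  · refine le_inner_of_forall_arcDirection_mem (Real.cos_le_one _)
      fun k hk m hm hne hkm hmk => ?_
    rw [innerDual_innerDual] at hkm hmk
    have hkm' : ⟪k, m⟫ ∈ Set.Ioo (-1) 1 :=
      ⟨hK.dual.neg_one_lt_inner hk hm, (inner_lt_one_iff_real_of_norm_eq_one hk.2 hm.2).2 hne⟩
    have hmk' : ⟪m, k⟫ ∈ Set.Ioo (-1) 1 := by rwa [real_inner_comm]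
    lift k to Sph d using mem_sphere_zero_iff_norm.2 hk.2
    lift m to Sph d using mem_sphere_zero_iff_norm.2 hm.2
    have hk_neg : k ≠ -m := by
      rintro rfl
      exact hK.dual.neg_notMem hm.1 (ne_zero_of_mem_unitVectors hm) hk.1
    have hle := (h k ((hsupports k).2 ⟨hk, _, ⟨hkm, norm_arcDirection hk.2 hm.2 hkm'⟩,
      inner_arcDirection_left hk.2 _⟩)).2 ⟨m, (hsupports m).2 ⟨hm, _,
        ⟨hmk, norm_arcDirection hm.2 hk.2 hmk'⟩, inner_arcDirection_left hm.2 _⟩,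
      isLuneThickness_iff.2 ⟨fun h0 => hne (congrArg _ h0), hk_neg, rfl⟩⟩
    exact (sdist_le_iff hwI).1 (by linarith)
  · intro k hk x hx hkx
    rw [innerDual_innerDual] at hx
    lift k to Sph d using mem_sphere_zero_iff_norm.2 hk.2
    obtain ⟨⟨m, hm, hkm⟩, -⟩ := h k ((hsupports k).2 ⟨hk, x, hx, hkx⟩)
    obtain ⟨-, -, rfl⟩ := isLuneThickness_iff.1 hkm
    exact ⟨m.1, ((hsupports m).1 hm).1, by rw [sub_sub_cancel, cos_sdist]⟩

lemma isOfConstantWidth_of_hasConstantAngle_innerDual (hK : IsRegularCone K)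
    (hw : w ∈ Set.Ioo 0 Real.pi)
    (h : HasConstantAngle (innerDual (SetLike.coe K)) (Real.pi - w)) :
    IsOfConstantWidth (sphericalTrace K) w := by
  intro k hk
  have hsupports := fun m : Sph d => supports_sphericalTrace_iff (m := m) hK.interior_nonempty
  have hwI : Real.pi - w ∈ Set.Ioo 0 Real.pi := ⟨by linarith [hw.2], by linarith [hw.1]⟩
  obtain ⟨hkK, x, hx, hkx⟩ := (hsupports k).1 hk
  constructor
  · obtain ⟨m, hm, hkm⟩ := h.exists_inner_eq_cos k.1 hkK x (by rwa [innerDual_innerDual]) hkx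
    lift m to Sph d using mem_sphere_zero_iff_norm.2 hm.2
    have hdist : sdist k m = Real.pi - w := (sdist_eq_iff (Set.Ioo_subset_Icc_self hwI)).2 hkm
    have hne : k ≠ m := by
      rintro rfl
      exact hwI.1.ne ((sdist_self k).symm.trans hdist)
    have hne' : k ≠ -m := by
      rintro rfl
      exact hK.dual.neg_notMem hm.1 (ne_zero_of_mem_unitVectors hm) hkK.1
    have hmin : ∀ u ∈ unitVectors (innerDual (SetLike.coe K)), ⟪m.1, k.1⟫ ≤ ⟪u, k.1⟫ :=
      fun u hu => by
        rw [real_inner_comm, hkm, real_inner_comm]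
        exact h.cos_le_inner _ hkK u hu
    have hmk : ⟪m.1, k.1⟫ ∈ Set.Ioo (-1) 1 := by
      rw [real_inner_comm]
      exact inner_mem_Ioo hne hne'
    have hx' : arcDirection m.1 k.1 ∈ unitVectors K :=
      ⟨by simpa only [innerDual_innerDual] using arcDirection_mem_innerDual hm hmin,
        norm_arcDirection hm.2 hkK.2 hmk⟩
    exact ⟨m, (hsupports m).2 ⟨hm, _, hx', inner_arcDirection_left hm.2 _⟩,
      isLuneThickness_iff.2 ⟨hne, hne', by rw [hdist, sub_sub_cancel]⟩⟩
  · rintro t ⟨m, hm, hkm⟩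
    obtain ⟨-, -, rfl⟩ := isLuneThickness_iff.1 hkm
    have := (sdist_le_iff (Set.Ioo_subset_Icc_self hwI)).2
      (h.cos_le_inner _ hkK _ ((hsupports m).1 hm).1)
    linarith

end IsRegularCone

theorem IsRegularCone.isOfConstantWidth_iff (hK : IsRegularCone K)
    (hfr : (frontier (sphericalTrace K)).Nonempty) :
    IsOfConstantWidth (sphericalTrace K) w ↔
      w ∈ Set.Ioo 0 Real.pi ∧ HasConstantAngle (innerDual (SetLike.coe K)) (Real.pi - w) := by
  refine ⟨fun h => ?_, fun h => hK.isOfConstantWidth_of_hasConstantAngle_innerDual h.1 h.2⟩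
  obtain ⟨p, hp⟩ := hfr
  obtain ⟨hpK, k, hk, hpk⟩ := (mem_frontier_sphericalTrace_iff hK.interior_nonempty).1 hp
  lift k to Sph d using mem_sphere_zero_iff_norm.2 hk.2
  have hsupports := (supports_sphericalTrace_iff hK.interior_nonempty).2
    ⟨hk, p.1, hpK, by rwa [real_inner_comm]⟩
  have hw := (h k hsupports).mem_Ioo
  exact ⟨hw, hK.hasConstantAngle_innerDual_of_isOfConstantWidth hw h⟩

theorem IsRegularCone.isOfConstantWidth_iff_isOfConstantDiameter (hK : IsRegularCone K)
    (hfr : (frontier (sphericalTrace K)).Nonempty) :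
    IsOfConstantWidth (sphericalTrace K) w ↔ IsOfConstantDiameter (sphericalTrace K) w := by
  rw [hK.isOfConstantWidth_iff hfr, hK.isOfConstantDiameter_iff hfr]
  exact and_congr_right fun hw => hasConstantAngle_innerDual_iff hK hw

namespace IsConvexBody

/-- The cone over a spherical convex body `W`: the nonnegative multiples of the points of `W`. -/
def cone (hW : IsConvexBody W) : ProperCone ℝ (EuclideanSpace ℝ (Fin (d + 1))) where
  carrier := {x | ∃ a ∈ W, x = ‖x‖ • a.1}
  zero_mem' := by
    obtain ⟨o, ho⟩ := hW.2.2
    exact ⟨o, interior_subset ho, by simp⟩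
  add_mem' := by
    rintro x y ⟨a, ha, hx⟩ ⟨b, hb, hy⟩
    rcases eq_or_ne (x + y) 0 with h0 | h0
    · exact ⟨a, ha, by rw [h0, norm_zero, zero_smul]⟩
    · refine ⟨⟨_, mem_sphere_zero_iff_norm.2 (NormedSpace.norm_normalize_eq_one_iff.2 h0)⟩,
        hW.2.1.2 a ha b hb ⟨‖x + y‖⁻¹ * ‖x‖, ‖x + y‖⁻¹ * ‖y‖, by positivity, by positivity, ?_⟩,
        (NormedSpace.norm_smul_normalize _).symm⟩
      rw [mul_smul, mul_smul, ← hx, ← hy, ← smul_add]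
      rfl
  smul_mem' := by
    rintro ⟨r, hr⟩ x ⟨a, ha, hx⟩
    refine ⟨a, ha, ?_⟩
    change r • x = ‖r • x‖ • a.1
    rw [norm_smul, Real.norm_of_nonneg hr, mul_smul, ← hx]
  isClosed' := by
    have hclosed : IsClosed {p : EuclideanSpace ℝ (Fin (d + 1)) × Sph d |
        p.2 ∈ W ∧ p.1 = ‖p.1‖ • p.2.1} :=
      (hW.1.preimage continuous_snd).inter (isClosed_eq continuous_fst (by fun_prop))
    convert! isClosedMap_fst_of_compactSpace _ hclosed using 1
    ext x
    simp

lemma mem_cone (hW : IsConvexBody W) {x : EuclideanSpace ℝ (Fin (d + 1))} :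
    x ∈ hW.cone ↔ ∃ a ∈ W, x = ‖x‖ • a.1 := Iff.rfl

lemma sphericalTrace_cone (hW : IsConvexBody W) : sphericalTrace hW.cone = W := by
  ext a
  refine ⟨fun ha => ?_, fun ha => hW.mem_cone.2 ⟨a, ha, by rw [norm_coe, one_smul]⟩⟩
  obtain ⟨b, hb, hab⟩ := hW.mem_cone.1 ha
  rw [norm_coe, one_smul] at hab
  exact Subtype.ext hab ▸ hb

lemma isRegularCone_cone (hW : IsConvexBody W) : IsRegularCone hW.cone where
  interior_nonempty := by
    obtain ⟨o, ho⟩ := hW.2.2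
    rw [← hW.sphericalTrace_cone] at ho
    exact ⟨o.1, mem_interior_preimage_coe_iff.1 ho⟩
  interior_innerDual_nonempty := by
    refine interior_innerDual_nonempty_of_forall_neg_notMem fun x hx hx0 hnx => ?_
    obtain ⟨a, ha, hxa⟩ := hW.mem_cone.1 hx
    obtain ⟨b, hb, hxb⟩ := hW.mem_cone.1 hnx
    rw [norm_neg, neg_eq_iff_eq_neg, ← smul_neg] at hxb
    have hab : a = -b :=
      Subtype.ext (smul_right_injective _ (norm_ne_zero_iff.2 hx0) (hxa.symm.trans hxb))
    exact hW.2.1.1 b hb (hab ▸ ha)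

lemma frontier_nonempty (hd : 1 ≤ d) (hW : IsConvexBody W) : (frontier W).Nonempty := by
  have hrank : 1 < Module.rank ℝ (EuclideanSpace ℝ (Fin (d + 1))) := by
    rw [← Module.finrank_eq_rank, finrank_euclideanSpace_fin]
    exact_mod_cast Nat.lt_succ_of_le hd
  have : PreconnectedSpace (Sph d) :=
    isPreconnected_iff_preconnectedSpace.1 (isPreconnected_sphere hrank 0 1)
  obtain ⟨o, ho⟩ := hW.2.2
  refine nonempty_frontier_iff.2 ⟨⟨o, interior_subset ho⟩, fun h => ?_⟩
  exact hW.2.1.1 o (interior_subset ho) (h ▸ Set.mem_univ _)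

end IsConvexBody

end Sphere

end SphConvex

theorem mainTheorem6_general (d : ℕ) (hd : 1 ≤ d) (W : Set (SphConvex.Sph d))
    (hW : SphConvex.IsConvexBody W) (w : ℝ) :
    SphConvex.IsOfConstantWidth W w ↔ SphConvex.IsOfConstantDiameter W w := by
  have h := hW.isRegularCone_cone.isOfConstantWidth_iff_isOfConstantDiameter (w := w)
  rw [hW.sphericalTrace_cone] at h
  exact h (hW.frontier_nonempty hd)

theorem mainTheorem6 (d : ℕ) (hd : 2 ≤ d) (W : Set (SphConvex.Sph d))
    (hW : SphConvex.IsConvexBody W) (w : ℝ) :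
    (SphConvex.IsOfConstantWidth W w → SphConvex.IsOfConstantDiameter W w) ∧
      (Real.pi / 2 ≤ w → SphConvex.IsOfConstantDiameter W w →
        SphConvex.IsOfConstantWidth W w) :=
  have h := mainTheorem6_general d (one_le_two.trans hd) W hW w
  ⟨h.1, fun _ => h.2⟩
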